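/- Let $m=(m_0,m_1,\ldots)$ be a bounded sequence of integers $m_k\ge 2$, and let $G_m=\prod_{k\ge 0}\mathbb{Z}/m_k\mathbb{Z}$ be the corresponding (bounded) Vilenkin group, with the product measure $\mu$ of the uniform probability measures on the factors. Put $M_0=1$, $M_{k+1}=m_kM_k$, write each $n\in\mathbb{N}$ uniquely as $n=\sum_{j\ge 0}n_jM_j$ with $0\le n_j<m_j$, and for $n\ge 1$ let $$\langle n\rangle=\min\{j:n_j\ne 0\},\qquad |n|=\max\{j:n_j\neq 0\},\qquad \rho(n)=|n|-\langle n\rangle .$$ Let $r_k(x)=\exp(2\pi i x_k/m_k)$ and $\psi_n(x)=\prod_{k\ge 0} r_k(x)^{n_k}$ for $x=(x_0,x_1,\ldots)\in G_m$, and for $f\in L_1(G_m)$ let $$\widehat f(k)=\int_{G_m}f\,\overline{\psi_k}\,d\mu,\qquad S_nf=\sum_{k=0}^{n-1}\widehat f(k)\psi_k .$$ Let $f\in L_1(G_m)$ and let $(\alpha_k)_{k\in\mathbb{N}}$ be a strictly increasing sequence of positive integers with $\sup_{k\in\mathbb{N}}\rho(\alpha_k)<\infty$. Then $S_{\alpha_k}f\to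 f$ $\mu$-almost everywhere on $G_m$ as $k\to\infty$. -/

import Mathlib

open MeasureTheory Filter Topology
open scoped ENNReal

namespace Vilenkin

/-- The group `G_m`, the complete direct product of the cyclic groups `ℤ / m_k ℤ`. -/
abbrev G (m : ℕ → ℕ) : Type := ∀ k, ZMod (m k)

/-- The measure on `ℤ / m_k ℤ` that gives mass `1 / m_k` to every point. -/
noncomputable def coordMeasure (m : ℕ → ℕ) (k : ℕ) : Measure (ZMod (m k)) :=
  (m k : ℝ≥0∞)⁻¹ • Measure.count

/-- The product of the measures `coordMeasure m k`: normalized Haar measure on `G_m`. -/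
noncomputable def haar (m : ℕ → ℕ) : Measure (G m) :=
  Measure.infinitePi (coordMeasure m)

/-- `M_0 = 1`, `M_{k+1} = m_k M_k`. -/
def M (m : ℕ → ℕ) : ℕ → ℕ
  | 0 => 1
  | k + 1 => m k * M m k

/-- The `j`-th digit `n_j` of `n` in the number system `n = ∑ n_j M_j`, `0 ≤ n_j < m_j`. -/
def digit (m : ℕ → ℕ) (n j : ℕ) : ℕ := n / M m j % m j

/-- `⟨n⟩ = min {j | n_j ≠ 0}` (used for `n ≠ 0`). -/
noncomputable def low (m : ℕ → ℕ) (n : ℕ) : ℕ := sInf {j | digit m n j ≠ 0}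

/-- `|n| = max {j | n_j ≠ 0}` (used for `n ≠ 0`). -/
noncomputable def high (m : ℕ → ℕ) (n : ℕ) : ℕ := sSup {j | digit m n j ≠ 0}

/-- `ρ(n) = |n| - ⟨n⟩`. -/
noncomputable def rho (m : ℕ → ℕ) (n : ℕ) : ℕ := high m n - low m n

/-- The generalized Rademacher functions `r_k(x) = exp (2 π i x_k / m_k)`. -/
noncomputable def rademacher (m : ℕ → ℕ) (k : ℕ) (x : G m) : ℂ :=
  Complex.exp (2 * Real.pi * Complex.I * ((x k).val : ℂ) / (m k : ℂ))

/-- The Vilenkin functions `ψ_n = ∏_k r_k ^ n_k`. All factors with `k ≥ n` are `1`, because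
`n_k = 0` there (`digit_eq_zero`), so the product is taken over `k < n`. -/
noncomputable def psi (m : ℕ → ℕ) (n : ℕ) (x : G m) : ℂ :=
  ∏ k ∈ Finset.range n, rademacher m k x ^ digit m n k

/-- The Vilenkin-Fourier coefficients of `f`. -/
noncomputable def fourierCoeff (m : ℕ → ℕ) (f : G m → ℂ) (k : ℕ) : ℂ :=
  ∫ x, f x * (starRingEnd ℂ) (psi m k x) ∂(haar m)

/-- The partial sums `S_n f = ∑_{k < n} f̂(k) ψ_k`. -/
noncomputable def partialSum (m : ℕ → ℕ) (n : ℕ) (f : G m → ℂ) (x : G m) : ℂ :=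
  ∑ k ∈ Finset.range n, fourierCoeff m f k * psi m k x

theorem lt_M {m : ℕ → ℕ} (hm : ∀ k, 2 ≤ m k) (k : ℕ) : k < M m k := by
  induction k with
  | zero => simp [M]
  | succ k ih =>
    have := Nat.mul_le_mul_right (M m k) (hm k)
    simp only [M]
    omega

theorem digit_eq_zero {m : ℕ → ℕ} (hm : ∀ k, 2 ≤ m k) {n j : ℕ} (h : n ≤ j) :
    digit m n j = 0 := by
  simp [digit, Nat.div_eq_of_lt (h.trans_lt (lt_M hm j))]

theorem digit_lt {m : ℕ → ℕ} (hm : ∀ k, 2 ≤ m k) (n j : ℕ) : digit m n j < m j :=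
  Nat.mod_lt _ (by have := hm j; omega)

theorem sum_digit_mul_M {m : ℕ → ℕ} (hm : ∀ k, 2 ≤ m k) (n : ℕ) :
    ∑ j ∈ Finset.range n, digit m n j * M m j = n := by
  have key : ∀ k, ∑ j ∈ Finset.range k, digit m n j * M m j = n % M m k := by
    intro k
    induction k with
    | zero => simp [M, Nat.mod_one]
    | succ k ih =>
      rw [Finset.sum_range_succ, ih, M, mul_comm (m k), Nat.mod_mul, digit]
      ring
  rw [key, Nat.mod_eq_of_lt (lt_M hm n)]

theorem isProbabilityMeasure_coordMeasure {m : ℕ → ℕ} (hm : ∀ k, 2 ≤ m k) (k : ℕ) :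
    IsProbabilityMeasure (coordMeasure m k) := by
  haveI : NeZero (m k) := ⟨by have := hm k; omega⟩
  refine ⟨?_⟩
  have h : (m k : ℝ≥0∞) ≠ 0 := by exact_mod_cast NeZero.ne (m k)
  simp [coordMeasure, Measure.count_apply, ENat.card_eq_coe_fintype_card, ZMod.card,
    ENNReal.inv_mul_cancel h (ENNReal.natCast_ne_top _)]

theorem isProbabilityMeasure_haar {m : ℕ → ℕ} (hm : ∀ k, 2 ≤ m k) :
    IsProbabilityMeasure (haar m) := by
  haveI := isProbabilityMeasure_coordMeasure hm
  unfold haar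
  infer_instance

end Vilenkin

namespace Vilenkin

/-! ### Mixed-radix digits. -/

section Digits

variable {m : ℕ → ℕ}

/-! Write $L=\langle n\rangle$. Then $M_L\mid n$, and boundedness of $m$ and $\rho$ gives $n\le C
M_L$ with $C$ fixed (`le_pow_mul_M_low`). The Dirichlet kernel $\sum_{k<n}\psi_k$ vanishes off the
cylinder of level $L$ about $0$ (`sum_psi_eq_zero`) and is at most $n$ on it, so for every constant
$c$, $|S_nf(x)-c|\le C\,E[|f-c|\mid\mathcal F_L](x)$ (`norm_partialSum_sub_const_le`). Since
$\langle\alpha_k\rangle\to\infty$, martingale convergence sends the right side to $C|f(x)-c|$ a.e.,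
simultaneously for all $c$ in a countable dense set. Taking $c$ close to $f(x)$ finishes the proof;
no maximal inequality is needed. -/

theorem M_pos (hm : ∀ k, 2 ≤ m k) (k : ℕ) : 0 < M m k := (Nat.zero_le k).trans_lt (lt_M hm k)

theorem M_dvd_M {i j : ℕ} (h : i ≤ j) : M m i ∣ M m j := by
  induction j, h using Nat.le_induction with
  | base => exact dvd_rfl
  | succ j _ ih => exact ih.trans (Dvd.intro_left _ rfl)

theorem mod_M_succ (n k : ℕ) : n % M m (k + 1) = n % M m k + digit m n k * M m k := by
  rw [M, mul_comm (m k), Nat.mod_mul, digit, mul_comm (M m k)]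

theorem M_dvd_of_digit_eq_zero {n L : ℕ} (h : ∀ j < L, digit m n j = 0) : M m L ∣ n := by
  apply Nat.dvd_of_mod_eq_zero
  induction L with
  | zero => simp [M, Nat.mod_one]
  | succ L ih =>
    rw [mod_M_succ, ih fun j hj => h j (by omega), h L (by omega)]
    simp

theorem exists_digit_ne_zero (hm : ∀ k, 2 ≤ m k) {n : ℕ} (hn : 0 < n) :
    ∃ j, digit m n j ≠ 0 := by
  by_contra! h
  have := sum_digit_mul_M hm n
  simp [h] at this
  omega

theorem M_low_dvd (n : ℕ) : M m (low m n) ∣ n :=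
  M_dvd_of_digit_eq_zero fun _ hj => by simpa using Nat.notMem_of_lt_sInf hj

theorem bddAbove_digit_ne_zero (hm : ∀ k, 2 ≤ m k) (n : ℕ) :
    BddAbove {j | digit m n j ≠ 0} :=
  ⟨n, fun _ hj => le_of_not_ge fun h => hj (digit_eq_zero hm h)⟩

theorem lt_M_high_succ (hm : ∀ k, 2 ≤ m k) (n : ℕ) : n < M m (high m n + 1) := by
  have key : ∀ k, n % M m (high m n + 1 + k) = n % M m (high m n + 1) := by
    intro k
    induction k with
    | zero => rfl
    | succ k ih =>
      have h0 : digit m n (high m n + 1 + k) = 0 := by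
        by_contra h
        have := le_csSup (bddAbove_digit_ne_zero hm n) h
        rw [← high] at this
        omega
      rw [← add_assoc, mod_M_succ, ih, h0, zero_mul, add_zero]
  -- At this level the modulus exceeds `n`, so the left side is `n` itself.
  have h1 := key n
  rw [Nat.mod_eq_of_lt ((Nat.le_add_left n _).trans_lt (lt_M hm _))] at h1
  exact h1.trans_lt (Nat.mod_lt n (M_pos hm (high m n + 1)))

theorem low_le_high (hm : ∀ k, 2 ≤ m k) {n : ℕ} (hn : 0 < n) : low m n ≤ high m n := by
  obtain ⟨j, hj⟩ := exists_digit_ne_zero hm hn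
  exact (Nat.sInf_le hj).trans (le_csSup (bddAbove_digit_ne_zero hm n) hj)

theorem M_add_le {B : ℕ} (hB : ∀ k, m k ≤ B) (i k : ℕ) : M m (i + k) ≤ B ^ k * M m i := by
  induction k with
  | zero => simp
  | succ k ih =>
    rw [← add_assoc, M, pow_succ', mul_assoc]
    exact Nat.mul_le_mul (hB _) ih

theorem le_pow_mul_M_low (hm : ∀ k, 2 ≤ m k) {B R n : ℕ} (hB : ∀ k, m k ≤ B) (hn : 0 < n)
    (hR : rho m n ≤ R) : n ≤ B ^ (R + 1) * M m (low m n) := by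
  have h1 := lt_M_high_succ hm n
  have h2 := low_le_high hm hn
  have h3 : high m n + 1 = low m n + (rho m n + 1) := by rw [rho]; omega
  have hB0 : 0 < B := (Nat.zero_lt_two.trans_le (hm 0)).trans_le (hB 0)
  rw [h3] at h1
  exact h1.le.trans ((M_add_le hB _ _).trans
    (Nat.mul_le_mul_right _ (Nat.pow_le_pow_right hB0 (by omega))))

/-- If the lowest index stayed below `l`, then `α k` would be at most `C * M m l`, although `α k ≥
k`. -/
theorem tendsto_low (hm : ∀ k, 2 ≤ m k) {C : ℕ} {α : ℕ → ℕ} (hα : StrictMono α)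
    (hC : ∀ k, α k ≤ C * M m (low m (α k))) : Tendsto (fun k => low m (α k)) atTop atTop := by
  rw [tendsto_atTop]
  intro l
  filter_upwards [eventually_gt_atTop (C * M m l)] with k hk
  by_contra! h
  have h1 := Nat.le_of_dvd (M_pos hm l) (M_dvd_M (m := m) h.le)
  have := (hα.id_le k).trans ((hC k).trans (Nat.mul_le_mul_left C h1))
  simp only [id] at this
  omega

theorem digit_add_mul_M {J i : ℕ} (hm : ∀ k, 2 ≤ m k) {q d a : ℕ} (hd : d < m J)
    (ha : a < M m J) :
    digit m (q * M m (J + 1) + (d * M m J + a)) i =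
      if i = J then d else digit m (q * M m (J + 1) + a) i := by
  rcases lt_trichotomy i J with h | h | h
  · rw [if_neg h.ne]
    obtain ⟨c, hc⟩ := M_dvd_M (m := m) (Nat.succ_le_of_lt h)
    rw [Nat.succ_eq_add_one, M] at hc
    have : q * M m (J + 1) + (d * M m J + a) =
        q * M m (J + 1) + a + M m i * (m i * (d * c)) := by
      rw [hc]; ring
    rw [digit, digit, this, Nat.add_mul_div_left _ _ (M_pos hm i), Nat.add_mul_mod_self_left]
  · subst h
    have : q * M m (i + 1) + (d * M m i + a) = a + M m i * (d + m i * q) := by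
      rw [M]; ring
    rw [if_pos rfl, digit, this, Nat.add_mul_div_left _ _ (M_pos hm i), Nat.div_eq_of_lt ha,
      zero_add, Nat.add_mul_mod_self_left, Nat.mod_eq_of_lt hd]
  · rw [if_neg h.ne']
    obtain ⟨c, hc⟩ := M_dvd_M (m := m) (Nat.succ_le_of_lt h)
    rw [Nat.succ_eq_add_one] at hc
    have hlt : d * M m J + a < M m (J + 1) := by
      rw [M]; nlinarith
    have key : ∀ r < M m (J + 1), (q * M m (J + 1) + r) / M m i = q / c := by
      intro r hr
      rw [hc, ← Nat.div_div_eq_div_mul, mul_comm q, Nat.mul_add_div (M_pos hm _),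
        Nat.div_eq_of_lt hr, add_zero]
    rw [digit, digit, key _ hlt, key a ((Nat.le_add_left a _).trans_lt hlt)]

end Digits

theorem sum_range_mul_eq {A : Type*} [AddCommMonoid A] (g : ℕ → A) (a b : ℕ) :
    ∑ k ∈ Finset.range (a * b), g k =
      ∑ i ∈ Finset.range a, ∑ j ∈ Finset.range b, g (i * b + j) := by
  induction a with
  | zero => simp
  | succ a ih => rw [Nat.succ_mul, Finset.sum_range_add, ih, Finset.sum_range_succ]

/-! ### Vilenkin characters and the Dirichlet kernel. -/

section Characters

variable {m : ℕ → ℕ}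

theorem rademacher_eq [∀ k, NeZero (m k)] (k : ℕ) (x : G m) :
    rademacher m k x = ZMod.stdAddChar (x k) := by
  rw [ZMod.stdAddChar_apply, ZMod.toCircle_apply, rademacher]

theorem psi_eq_prod_range (hm : ∀ k, 2 ≤ m k) {n T : ℕ} (h : n ≤ T) (x : G m) :
    psi m n x = ∏ k ∈ Finset.range T, rademacher m k x ^ digit m n k := by
  refine Finset.prod_subset (Finset.range_subset_range.2 h) fun k _ hk => ?_
  rw [digit_eq_zero hm (by simpa using hk), pow_zero]

theorem psi_add (hm : ∀ k, 2 ≤ m k) (n : ℕ) (x y : G m) :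
    psi m n (x + y) = psi m n x * psi m n y := by
  have : ∀ k, NeZero (m k) := fun k => ⟨by have := hm k; omega⟩
  simp only [psi, ← Finset.prod_mul_distrib, ← mul_pow, rademacher_eq, Pi.add_apply,
    AddChar.map_add_eq_mul]

theorem norm_psi (hm : ∀ k, 2 ≤ m k) (n : ℕ) (x : G m) : ‖psi m n x‖ = 1 := by
  have : ∀ k, NeZero (m k) := fun k => ⟨by have := hm k; omega⟩
  simp [psi, rademacher_eq]

theorem psi_mul_conj_psi (hm : ∀ k, 2 ≤ m k) (n : ℕ) (x y : G m) :
    psi m n x * (starRingEnd ℂ) (psi m n y) = psi m n (x - y) := by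
  have h : psi m n x = psi m n (x - y) * psi m n y := by rw [← psi_add hm, sub_add_cancel]
  rw [h, mul_assoc, Complex.mul_conj, Complex.normSq_eq_norm_sq, norm_psi hm]
  simp

theorem psi_zero (x : G m) : psi m 0 x = 1 := by simp [psi]

/-- The range splits into full cycles of the `J`-th digit, the other digits being fixed. Each cycle
sums all powers of an `m J`-th root of unity different from `1`. -/
theorem sum_psi_eq_zero (hm : ∀ k, 2 ≤ m k) {n J : ℕ} (hn : M m (J + 1) ∣ n) {z : G m}
    (hz : z J ≠ 0) : ∑ k ∈ Finset.range n, psi m k z = 0 := by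
  have : ∀ k, NeZero (m k) := fun k => ⟨by have := hm k; omega⟩
  obtain ⟨q, rfl⟩ := hn
  rw [mul_comm, sum_range_mul_eq]
  refine Finset.sum_eq_zero fun i _ => ?_
  rw [show M m (J + 1) = m J * M m J from rfl, sum_range_mul_eq, Finset.sum_comm]
  refine Finset.sum_eq_zero fun a ha => ?_
  have ha' := Finset.mem_range.1 ha
  have hgeom : ∑ d ∈ Finset.range (m J), rademacher m J z ^ d = 0 := by
    have h1 : rademacher m J z ≠ 1 := by
      rw [rademacher_eq, ← AddChar.map_zero_eq_one (ZMod.stdAddChar (N := m J))]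
      exact fun h => hz (ZMod.injective_stdAddChar h)
    have h2 : rademacher m J z ^ m J = 1 := by
      rw [rademacher_eq, ← AddChar.map_nsmul_eq_pow]
      simp
    rw [geom_sum_eq h1, h2, sub_self, zero_div]
  -- The product bound does not depend on `d`, so the second factor leaves the geometric sum.
  have key : ∀ d ∈ Finset.range (m J), psi m (i * (m J * M m J) + (d * M m J + a)) z =
      rademacher m J z ^ d * ∏ k ∈ (Finset.range (i * (m J * M m J) + m J * M m J + J + 1)).erase J,
        rademacher m k z ^ digit m (i * (m J * M m J) + a) k := by
    intro d hd
    have hd' := Finset.mem_range.1 hd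
    have hlt : d * M m J + a < m J * M m J := by nlinarith
    rw [psi_eq_prod_range hm (T := i * (m J * M m J) + m J * M m J + J + 1) (by omega),
      ← Finset.mul_prod_erase _ _ (Finset.mem_range.2 (by omega : J < _))]
    have hdig := fun i' => digit_add_mul_M (i := i') (q := i) hm hd' ha'
    simp only [M] at hdig
    congr 1
    · rw [hdig, if_pos rfl]
    · refine Finset.prod_congr rfl fun k hk => ?_
      rw [hdig, if_neg (Finset.ne_of_mem_erase hk)]
  rw [Finset.sum_congr rfl key, ← Finset.sum_mul, hgeom, zero_mul]

end Characters

/-! ### Haar measure, kernel representation, martingale bound. -/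

section Integration

variable {m : ℕ → ℕ}

theorem map_add_right_coordMeasure [∀ k, NeZero (m k)] (k : ℕ) (a : ZMod (m k)) :
    (coordMeasure m k).map (· + a) = coordMeasure m k := by
  rw [coordMeasure, Measure.map_smul]
  congr 1
  exact map_add_right_eq_self _ a

theorem measurePreserving_add_right_haar (hm : ∀ k, 2 ≤ m k) (e : G m) :
    MeasurePreserving (· + e) (haar m) (haar m) := by
  have : ∀ k, NeZero (m k) := fun k => ⟨by have := hm k; omega⟩
  have := isProbabilityMeasure_coordMeasure hm
  refine ⟨by fun_prop, ?_⟩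
  have h := Measure.infinitePi_map_pi (μ := coordMeasure m) (f := fun k x => x + e k)
    fun k => measurable_add_const (e k)
  simp only [map_add_right_coordMeasure] at h
  exact h

theorem measurable_psi (n : ℕ) : Measurable (psi m n) := by
  refine Finset.measurable_fun_prod _ fun k _ => Measurable.pow_const ?_ _
  exact (Measurable.of_discrete (f := fun a : ZMod (m k) =>
    Complex.exp (2 * Real.pi * Complex.I * (a.val : ℂ) / (m k : ℂ)))).comp (measurable_pi_apply k)

/-- Translating by a unit vector `e` at a nonzero digit of `n` preserves the integral but multiplies
it by `psi m n e ≠ 1`. -/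
theorem integral_psi_eq_zero (hm : ∀ k, 2 ≤ m k) {n : ℕ} (hn : 0 < n) :
    ∫ x, psi m n x ∂(haar m) = 0 := by
  have : ∀ k, NeZero (m k) := fun k => ⟨by have := hm k; omega⟩
  obtain ⟨j, hj⟩ := exists_digit_ne_zero hm hn
  have hjn : j < n := by
    by_contra! h
    exact hj (digit_eq_zero hm h)
  let e : G m := Pi.single j 1
  have h1 : ∫ x, psi m n (x + e) ∂(haar m) = ∫ x, psi m n x ∂(haar m) :=
    (measurePreserving_add_right_haar hm e).integral_comp
      (MeasurableEquiv.addRight e).measurableEmbedding _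
  simp only [psi_add hm, integral_mul_const] at h1
  have he : psi m n e ≠ 1 := by
    rw [psi, Finset.prod_eq_single_of_mem j (Finset.mem_range.2 hjn)]
    · rw [rademacher_eq, ← AddChar.map_nsmul_eq_pow,
        ← AddChar.map_zero_eq_one (ZMod.stdAddChar (N := m j))]
      intro h
      have h2 := ZMod.injective_stdAddChar h
      simp only [e, Pi.single_eq_same, nsmul_eq_mul, mul_one] at h2
      rw [ZMod.natCast_eq_zero_iff] at h2
      exact hj (Nat.eq_zero_of_dvd_of_lt h2 (digit_lt hm n j))
    · intro k _ hk
      rw [rademacher_eq]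
      simp [e, hk]
  by_contra h
  exact he (by simpa [h] using h1)

theorem integrable_mul_conj_psi (hm : ∀ k, 2 ≤ m k) {f : G m → ℂ}
    (hf : Integrable f (haar m)) (n : ℕ) :
    Integrable (fun y => f y * (starRingEnd ℂ) (psi m n y)) (haar m) :=
  hf.mul_bdd (c := 1)
    (Complex.continuous_conj.measurable.comp (measurable_psi n)).aestronglyMeasurable
    (ae_of_all _ fun y => by simp [norm_psi hm])

theorem partialSum_sub_const (hm : ∀ k, 2 ≤ m k) {f : G m → ℂ} (hf : Integrable f (haar m))
    {n : ℕ} (hn : 0 < n) (c : ℂ) (x : G m) :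
    partialSum m n f x - c =
      ∫ y, (f y - c) * ∑ k ∈ Finset.range n, psi m k (x - y) ∂(haar m) := by
  have := isProbabilityMeasure_haar hm
  have hfc : Integrable (fun y => f y - c) (haar m) := hf.sub (integrable_const c)
  have hrw : ∀ y, (f y - c) * ∑ k ∈ Finset.range n, psi m k (x - y) =
      ∑ k ∈ Finset.range n, (f y - c) * (starRingEnd ℂ) (psi m k y) * psi m k x := by
    intro y
    rw [Finset.mul_sum]
    refine Finset.sum_congr rfl fun k _ => ?_
    rw [← psi_mul_conj_psi hm]
    ring
  simp only [hrw]
  rw [integral_finsetSum _ fun k _ => (integrable_mul_conj_psi hm hfc k).mul_const _]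
  have hk : ∀ k, ∫ y, (f y - c) * (starRingEnd ℂ) (psi m k y) * psi m k x ∂(haar m) =
      fourierCoeff m f k * psi m k x - if k = 0 then c else 0 := by
    intro k
    rw [integral_mul_const]
    simp only [sub_mul]
    rw [integral_sub (integrable_mul_conj_psi hm hf k)
      (integrable_mul_conj_psi hm (integrable_const c) k), integral_const_mul, integral_conj,
      ← fourierCoeff]
    split_ifs with h
    · subst h
      simp [psi_zero]
    · simp [integral_psi_eq_zero hm (Nat.pos_of_ne_zero h)]
  simp only [hk, Finset.sum_sub_distrib, partialSum]
  simp [hn.ne']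

/-- The cylinder `I_L(x)` of all points sharing the first `L` coordinates of `x`. -/
def cylinderAt (m : ℕ → ℕ) (L : ℕ) (x : G m) : Set (G m) :=
  Set.pi (Finset.range L) fun j => {x j}

theorem measurableSet_cylinderAt (L : ℕ) (x : G m) : MeasurableSet (cylinderAt m L x) :=
  MeasurableSet.pi (Finset.countable_toSet _) fun _ _ => .of_discrete

theorem haar_cylinderAt (hm : ∀ k, 2 ≤ m k) (L : ℕ) (x : G m) :
    (haar m).real (cylinderAt m L x) = (M m L : ℝ)⁻¹ := by
  have := isProbabilityMeasure_coordMeasure hm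
  have h : haar m (cylinderAt m L x) = ∏ k ∈ Finset.range L, (m k : ℝ≥0∞)⁻¹ := by
    rw [haar, cylinderAt, Measure.infinitePi_pi _ fun _ _ => .of_discrete]
    simp [coordMeasure]
  rw [Measure.real, h, ENNReal.toReal_prod]
  clear h
  induction L with
  | zero => simp [M]
  | succ L ih =>
    rw [Finset.prod_range_succ, ih, M]
    simp [mul_comm]

/-- The filtration of events depending on the first `L` coordinates. -/
def coordFiltration (m : ℕ → ℕ) : Filtration ℕ (inferInstance : MeasurableSpace (G m)) where
  seq L := Filtration.piFinset (X := fun k => ZMod (m k)) (Finset.range L)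
  mono' _ _ h := Filtration.piFinset.mono (Finset.range_subset_range.2 h)
  le' _ := Filtration.piFinset.le _

theorem coordFiltration_apply (L : ℕ) :
    coordFiltration m L = MeasurableSpace.comap (Finset.range L).restrict MeasurableSpace.pi :=
  rfl

theorem iSup_coordFiltration : ⨆ L, coordFiltration m L = MeasurableSpace.pi := by
  refine le_antisymm (iSup_le (coordFiltration m).le) (iSup_le fun k => ?_)
  refine le_trans ?_ (le_iSup _ (k + 1))
  have h : (fun x : G m => x k) =
      (fun z : ∀ i : Finset.range (k + 1), ZMod (m i) => z ⟨k, by simp⟩) ∘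
        (Finset.range (k + 1)).restrict := rfl
  rw [coordFiltration_apply]
  change MeasurableSpace.comap (fun x : G m => x k) _ ≤ _
  rw [h, ← MeasurableSpace.comap_comp]
  exact MeasurableSpace.comap_mono (measurable_pi_apply
    (X := fun i : Finset.range (k + 1) => ZMod (m i)) ⟨k, by simp⟩).comap_le

theorem ae_tendsto_condExp_coordFiltration (hm : ∀ k, 2 ≤ m k) {g : G m → ℝ}
    (hg : Integrable g (haar m)) :
    ∀ᵐ x ∂(haar m), Tendsto (fun L => ((haar m)[g | coordFiltration m L]) x) atTop (𝓝 (g x)) := by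
  have := isProbabilityMeasure_haar hm
  have h := condExp_of_aestronglyMeasurable' (le_refl _) hg.aestronglyMeasurable hg
  filter_upwards [tendsto_ae_condExp (ℱ := coordFiltration m) (μ := haar m) g, h] with x hx hx'
  rwa [iSup_coordFiltration, hx'] at hx

/-- The cylinder is an atom of the `L`-th σ-algebra, so the conditional expectation is constant on
it. The identity holds at every `x`, not just a.e. -/
theorem setIntegral_cylinderAt (hm : ∀ k, 2 ≤ m k) {g : G m → ℝ} (hg : Integrable g (haar m))
    (L : ℕ) (x : G m) :
    ∫ y in cylinderAt m L x, g y ∂(haar m) =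
      (M m L : ℝ)⁻¹ * ((haar m)[g | coordFiltration m L]) x := by
  have := isProbabilityMeasure_haar hm
  have hset : MeasurableSet[coordFiltration m L] (cylinderAt m L x) := by
    refine ⟨{(Finset.range L).restrict x}, .singleton _, ?_⟩
    ext y
    simp [cylinderAt, funext_iff, Set.mem_pi]
  have hfac : Function.FactorsThrough ((haar m)[g | coordFiltration m L])
      (Finset.range L).restrict := stronglyMeasurable_condExp.factorsThrough
  rw [← setIntegral_condExp ((coordFiltration m).le L) hg hset,
    setIntegral_congr_fun (g := fun _ => ((haar m)[g | coordFiltration m L]) x)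
      (measurableSet_cylinderAt L x), setIntegral_const, haar_cylinderAt hm, smul_eq_mul]
  intro y hy
  refine hfac (funext fun k => ?_)
  simpa using hy k k.2

theorem norm_partialSum_sub_const_le (hm : ∀ k, 2 ≤ m k) {f : G m → ℂ}
    (hf : Integrable f (haar m)) {n L C : ℕ} (hn : 0 < n) (hL : M m L ∣ n) (hC : n ≤ C * M m L)
    (c : ℂ) (x : G m) :
    ‖partialSum m n f x - c‖ ≤
      C * ((haar m)[fun y => ‖f y - c‖ | coordFiltration m L]) x := by
  have := isProbabilityMeasure_haar hm
  have hg : Integrable (fun y => ‖f y - c‖) (haar m) := (hf.sub (integrable_const c)).norm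
  have hM : (0 : ℝ) < M m L := by exact_mod_cast M_pos hm L
  have hle : ∀ y, ‖(f y - c) * ∑ k ∈ Finset.range n, psi m k (x - y)‖ ≤
      (cylinderAt m L x).indicator (fun y => n * ‖f y - c‖) y := by
    intro y
    by_cases hy : y ∈ cylinderAt m L x
    · rw [Set.indicator_of_mem hy, norm_mul, mul_comm]
      refine mul_le_mul_of_nonneg_right ((norm_sum_le _ _).trans ?_) (norm_nonneg _)
      simp [norm_psi hm]
    · rw [Set.indicator_of_notMem hy]
      obtain ⟨j, hj, hxy⟩ : ∃ j < L, y j ≠ x j := by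
        simpa [cylinderAt, Set.mem_pi] using hy
      rw [sum_psi_eq_zero hm ((M_dvd_M (Nat.succ_le_of_lt hj)).trans hL)
        (sub_ne_zero.2 hxy.symm : (x - y) j ≠ 0)]
      simp
  have hpos : 0 ≤ (M m L : ℝ)⁻¹ * ((haar m)[fun y => ‖f y - c‖ | coordFiltration m L]) x := by
    rw [← setIntegral_cylinderAt hm hg]
    exact integral_nonneg fun y => norm_nonneg _
  calc ‖partialSum m n f x - c‖
      ≤ ∫ y, (cylinderAt m L x).indicator (fun y => n * ‖f y - c‖) y ∂(haar m) := by
        rw [partialSum_sub_const hm hf hn]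
        exact norm_integral_le_of_norm_le
          ((hg.const_mul _).indicator (measurableSet_cylinderAt L x)) (ae_of_all _ hle)
    _ = n * ((M m L : ℝ)⁻¹ * ((haar m)[fun y => ‖f y - c‖ | coordFiltration m L]) x) := by
        rw [integral_indicator (measurableSet_cylinderAt L x), integral_const_mul,
          setIntegral_cylinderAt hm hg]
    _ ≤ (C * M m L) *
          ((M m L : ℝ)⁻¹ * ((haar m)[fun y => ‖f y - c‖ | coordFiltration m L]) x) :=
        mul_le_mul_of_nonneg_right (by exact_mod_cast hC) hpos
    _ = C * ((haar m)[fun y => ‖f y - c‖ | coordFiltration m L]) x := by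
        field_simp

end Integration

end Vilenkin

theorem mainTheorem2 (m : ℕ → ℕ) (hm : ∀ k, 2 ≤ m k) (hbdd : BddAbove (Set.range m))
    (f : Vilenkin.G m → ℂ) (hf : Integrable f (Vilenkin.haar m))
    (α : ℕ → ℕ) (hα : StrictMono α) (hpos : ∀ k, 0 < α k)
    (hρ : BddAbove (Set.range fun k => Vilenkin.rho m (α k))) :
    ∀ᵐ x ∂(Vilenkin.haar m),
      Tendsto (fun k => Vilenkin.partialSum m (α k) f x) atTop (𝓝 (f x)) := by
  have := Vilenkin.isProbabilityMeasure_haar hm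
  obtain ⟨B, hB⟩ := hbdd
  obtain ⟨R, hR⟩ := hρ
  obtain ⟨C, hC⟩ : ∃ C : ℕ, ∀ k, α k ≤ C * Vilenkin.M m (Vilenkin.low m (α k)) :=
    ⟨_, fun k => Vilenkin.le_pow_mul_M_low hm (fun k => hB ⟨k, rfl⟩) (hpos k) (hR ⟨k, rfl⟩)⟩
  have hlow := Vilenkin.tendsto_low hm hα hC
  have hae : ∀ᵐ x ∂(Vilenkin.haar m), ∀ i : ℕ, Tendsto
      (fun L => ((Vilenkin.haar m)[fun y => ‖f y - TopologicalSpace.denseSeq ℂ i‖ |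
        Vilenkin.coordFiltration m L]) x) atTop (𝓝 ‖f x - TopologicalSpace.denseSeq ℂ i‖) :=
    ae_all_iff.2 fun i => Vilenkin.ae_tendsto_condExp_coordFiltration hm
      (hf.sub (integrable_const _)).norm
  filter_upwards [hae] with x hx
  rw [Metric.tendsto_atTop']
  intro ε hε
  -- The kernel bound contributes at most `C` times this radius, and replacing the constant by `f x`
  -- less than one more.
  have hδ : 0 < ε / (C + 2) := by positivity
  obtain ⟨i, hi⟩ := (TopologicalSpace.denseRange_denseSeq ℂ).exists_dist_lt (f x) hδ
  rw [dist_eq_norm] at hi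
  obtain ⟨K, hK⟩ := eventually_atTop.1 (((hx i).comp hlow).eventually_lt_const hi)
  refine ⟨K, fun k hk => ?_⟩
  have h1 := Vilenkin.norm_partialSum_sub_const_le hm hf (hpos k) (Vilenkin.M_low_dvd (α k)) (hC k)
    (TopologicalSpace.denseSeq ℂ i) x
  have h2 := mul_le_mul_of_nonneg_left (hK k hk.le).le (Nat.cast_nonneg (α := ℝ) C)
  simp only [Function.comp_apply] at h2
  have h3 := dist_triangle_right (Vilenkin.partialSum m (α k) f x) (f x)
    (TopologicalSpace.denseSeq ℂ i)
  rw [dist_eq_norm, dist_eq_norm, dist_eq_norm] at h3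
  have h4 : (C + 2) * (ε / (C + 2)) = ε := by field_simp
  rw [dist_eq_norm]
  linarith
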